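/- Let $(\mathbb K,\delta)$ be a sufficiently saturated differentially closed field of characteristic zero (that is, an existentially closed model of the theory of differential integral domains of characteristic zero), and let $(k,\delta)$ be a differential subfield of $\mathbb K$ of cardinality less than the degree of saturation. For a finite tuple $a$ from $\mathbb K$, a complete type $p=\operatorname{tp}(a/k)$ is called finite dimensional if the sequence $\operatorname{tr.deg.}(a,\delta a,\dots,\delta^\ell a/k)$, $\ell=0,1,2,\dots$, is eventually constant (equivalently, if $k\langle a\rangle=k(a,\delta a,\delta^2a,\dots)$ has finite transcendence degree over $k$). Complete types $p,q$ over $k$ are interdefinable if for every $a\models p$ there is $b\models q$ with $\operatorname{dcl}(ka)=\operatorname{dcl}(kb)$. For an affine variety $V\subseteq\mathbb A^n$ over $k$ with ideal $I(V)\subseteq k[x]$, the prolongation $\tau V\subseteq\mathbb A^{2n}$ is defined by $f(x)=0$ and $f^\delta(x)+\sum_{i=1}^n\frac{\partial f}{\partial x_i}(x)\,y_i=0$ for all $f\in I(V)$, where $f^\delta$ is obtained from $f$ by applying $\delta$ to its coefficients. An affine $D$-variety over $(k,\delta)$ is a pair $(V,s)$ with $V$ an affine variety over $k$ and $s:V\to\tau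 V$ a morphism over $k$ that is a section of the projection $\tau V\to V$; it is irreducible if $V$ is irreducible over $k$. A $D$-point of $(V,s)$ is a point $a\in V(\mathbb K)$ such that $s$ maps $\{a\}$ into the prolongation of $\{a\}$ over $(\mathbb K,\delta)$ (equivalently, $s(a)=(a,\delta a)$). The generic type of an irreducible $(V,s)$ over $k$ is the complete type over $k$ asserting that $x$ is a $D$-point of $(V,s)$ contained in no proper subvariety of $V$ over $k$. Theorem. Every finite dimensional complete type over $k$ (in finitely many variables) is interdefinable with the generic type over $k$ of some irreducible affine $D$-variety over $(k,\delta)$. -/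

import Mathlib

open FirstOrder FirstOrder.Language Cardinal

universe u v

noncomputable section

namespace DCF

/-! ## The language of differential rings -/

/-- Function symbols `0, 1, +, -, ×, δ`. -/
inductive DRingFunc : ℕ → Type
  | zero : DRingFunc 0
  | one : DRingFunc 0
  | neg : DRingFunc 1
  | add : DRingFunc 2
  | mul : DRingFunc 2
  | der : DRingFunc 1

/-- The language of differential rings. It has no relation symbols besides equality. -/
def dRing : FirstOrder.Language.{0, 0} where
  Functions := DRingFunc
  Relations := fun _ => Empty

/-- Every differential ring is a structure in the language of differential rings. -/
instance dRingStructure (R : Type*) [CommRing R] [Differential R] : dRing.Structure R where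
  funMap := fun {n} f =>
    match n, f with
    | _, .zero => fun _ => 0
    | _, .one => fun _ => 1
    | _, .neg => fun x => -x 0
    | _, .add => fun x => x 0 + x 1
    | _, .mul => fun x => x 0 * x 1
    | _, .der => fun x => Differential.deriv (x 0)
  RelMap := fun r _ => Empty.elim r

/-! ## Differentially closed fields, saturation, types, definable closure -/

/-- `φ` is an atomic formula or the negation of one (a polynomial equation or inequation in the
derivatives of the variables). -/
def IsLiteral {α : Type*} (φ : dRing.Formula α) : Prop :=
  BoundedFormula.IsAtomic φ ∨ ∃ ψ : dRing.Formula α, BoundedFormula.IsAtomic ψ ∧ φ = ∼ψ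

/-- `K` is a differentially closed field of characteristic zero: an existentially closed model of
the theory of differential integral domains of characteristic zero. That is, every finite system of
atomic and negated atomic formulas with coefficients in `K` that has a solution in some differential
integral domain extending `K` has a solution in `K`. -/
structure IsDCF (K : Type u) [CommRing K] [Differential K] : Prop where
  isDomain : IsDomain K
  charZero : CharZero K
  existentiallyClosed :
    ∀ (R : Type u) [CommRing R] [IsDomain R] [CharZero R] [Differential R] [Algebra K R]
      [DifferentialAlgebra K R], Function.Injective (algebraMap K R) →
      ∀ (n : ℕ) (S : Finset (dRing.Formula (K ⊕ Fin n))), (∀ φ ∈ S, IsLiteral φ) →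
        (∃ x : Fin n → R, ∀ φ ∈ S, φ.Realize (Sum.elim (algebraMap K R) x)) →
        ∃ x : Fin n → K, ∀ φ ∈ S, φ.Realize (Sum.elim id x)

section ModelTheory

variable {K : Type u} [CommRing K] [Differential K]

/-- `S_n(A)`: complete `n`-types over the set of parameters `A ⊆ K`, that is, maximal sets of
formulas with parameters in `A`, in `n` free variables, consistent with the theory of
`(K, a)_{a ∈ A}`. -/
abbrev TypeOver (A : Set K) (n : ℕ) :=
  (dRing[[A]].completeTheory K).CompleteType (Fin n)

/-- `a ⊨ p`, that is, `p = tp(a/A)`. -/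
def Realizes {A : Set K} {n : ℕ} (a : Fin n → K) (p : TypeOver A n) : Prop :=
  (dRing[[A]].completeTheory K).typeOf a = p

variable (K) in
/-- `K` is `κ`-saturated: every complete type over fewer than `κ` parameters is realised. -/
def IsSaturated (κ : Cardinal.{u}) : Prop :=
  ∀ A : Set K, #A < κ → ∀ (n : ℕ) (p : TypeOver A n), ∃ a : Fin n → K, Realizes a p

/-- The definable closure of `A`: all `c` such that `{c}` is definable with parameters in `A`. -/
def dcl (A : Set K) : Set K :=
  {c | A.Definable₁ dRing {c}}

/-- `p, q` over `A` are interdefinable: for every `a ⊨ p` there is `b ⊨ q` with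
`dcl(Aa) = dcl(Ab)`. -/
def Interdefinable {A : Set K} {m n : ℕ} (p : TypeOver A m) (q : TypeOver A n) : Prop :=
  ∀ a : Fin m → K, Realizes a p →
    ∃ b : Fin n → K, Realizes b q ∧ dcl (A ∪ Set.range a) = dcl (A ∪ Set.range b)

end ModelTheory

/-! ## Dimension of types -/

section Dimension

variable (k : Type v) {K : Type u} [Field k] [Field K] [Differential K] [Algebra k K]

/-- `dim(a/k)`: the sequence of transcendence degrees of `k(a, δa, …, δ^ℓ a)` over `k`,
`ℓ = 0, 1, 2, …`. -/
def dim {n : ℕ} (a : Fin n → K) (ℓ : ℕ) : Cardinal :=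
  Algebra.trdeg k
    (IntermediateField.adjoin k {x : K | ∃ i ≤ ℓ, ∃ j, x = (fun y : K => Differential.deriv y)^[i] (a j)})

/-- The parameter set `k`, as a subset of `K`. -/
abbrev params (K : Type u) [Field K] [Algebra k K] : Set K := Set.range (algebraMap k K)

variable {k} in
/-- `p ∈ S(k)` is finite dimensional: `dim(a/k)` is eventually constant, where `a ⊨ p`. -/
def FiniteDimensionalType {n : ℕ} (p : TypeOver (params k K) n) : Prop :=
  ∃ a : Fin n → K, Realizes a p ∧ ∃ N : ℕ, ∀ ℓ ≥ N, dim k a ℓ = dim k a N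

end Dimension

/-! ## Affine varieties over `k`, with points in the universal domain `K` -/

section Varieties

open MvPolynomial

/-- An affine variety over `k` in affine space with coordinates indexed by `ι`, given by its set of
`K`-points. -/
structure AffineVariety (k : Type v) (K : Type u) [Field k] [Field K] [Algebra k K]
    (ι : Type) where
  /-- The set of `K`-points. -/
  points : Set (ι → K)
  isClosed : ∃ I : Ideal (MvPolynomial ι k), points = zeroLocus K I

namespace AffineVariety

variable {k : Type v} {K : Type u} [Field k] [Field K] [Algebra k K] {ι : Type}

/-- The ideal `I(V)` of polynomials over `k` vanishing on `V`. -/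
def ideal (V : AffineVariety k K ι) : Ideal (MvPolynomial ι k) :=
  vanishingIdeal k V.points

/-- `V` is nonempty and not the union of two proper subvarieties over `k`. -/
def IsIrreducible (V : AffineVariety k K ι) : Prop :=
  V.points.Nonempty ∧ ∀ W₁ W₂ : AffineVariety k K ι,
    V.points ⊆ W₁.points ∪ W₂.points → V.points ⊆ W₁.points ∨ V.points ⊆ W₂.points

/-- A map between affine varieties is a morphism over `k` if it is given by polynomials
over `k`. -/
def IsMorphism {ι' : Type} (V : AffineVariety k K ι) (W : AffineVariety k K ι')
    (f : V.points → W.points) : Prop :=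
  ∃ g : ι' → MvPolynomial ι k, ∀ (v : V.points) (j : ι'), (f v).1 j = aeval v.1 (g j)

/-- The singleton `{a}`, as a variety over `K`. -/
def point (a : ι → K) : AffineVariety K K ι where
  points := {a}
  isClosed := by
    refine ⟨Ideal.span (Set.range fun i => X i - C (a i)), ?_⟩
    ext x
    simp only [Set.mem_singleton_iff, zeroLocus_span]
    constructor
    · rintro rfl
      simp
    · intro h
      funext i
      have := h (X i - C (a i)) ⟨i, rfl⟩
      simpa [sub_eq_zero] using this

variable [Differential k]

/-- `f^δ`: apply `δ` to the coefficients of `f`. -/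
def mapDeriv (f : MvPolynomial ι k) : MvPolynomial ι k :=
  ∑ m ∈ f.support, monomial m (Differential.deriv (f.coeff m))

/-- `f^δ(x) + ∑ ∂f/∂xᵢ(x) yᵢ`, where the variables `xᵢ`, `yᵢ` are those indexed by `Sum.inl i`
and `Sum.inr i`. -/
def prolongPoly [Fintype ι] (f : MvPolynomial ι k) : MvPolynomial (ι ⊕ ι) k :=
  rename Sum.inl (mapDeriv f) + ∑ i, rename Sum.inl (pderiv i f) * X (Sum.inr i)

/-- The prolongation `τV` of `V` over `(k, δ)`: the variety defined by `f(x) = 0` and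
`f^δ(x) + ∑ ∂f/∂xᵢ(x) yᵢ = 0`, for all `f ∈ I(V)`. -/
def prolongation [Fintype ι] (V : AffineVariety k K ι) : AffineVariety k K (ι ⊕ ι) where
  points := zeroLocus K (Ideal.span
    ({g | ∃ f ∈ V.ideal, g = rename Sum.inl f} ∪ {g | ∃ f ∈ V.ideal, g = prolongPoly f}))
  isClosed := ⟨_, rfl⟩

end AffineVariety

/-- An affine `D`-variety `(V, s)` over `(k, δ)`, `V ⊆ 𝔸ⁿ`: an affine variety `V` over `k` with a
morphism `s : V → τV` over `k` that is a section of the projection `τV → V`. -/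
structure DVariety (k : Type v) (K : Type u) [Field k] [Differential k] [Field K] [Algebra k K]
    (n : ℕ) where
  /-- The underlying affine variety. -/
  V : AffineVariety k K (Fin n)
  /-- The section. -/
  s : V.points → V.prolongation.points
  isMorphism : V.IsMorphism V.prolongation s
  isSection : ∀ (v : V.points) (i : Fin n), (s v).1 (Sum.inl i) = v.1 i

namespace DVariety

variable {k : Type v} {K : Type u} [Field k] [Differential k] [Field K] [Algebra k K] {n : ℕ}

/-- A variety `W` over `(F, δ)`, where `F` is a differential field between `k` and `K`, is a
`D`-subvariety of (the base extension to `F` of) `(V, s)`: it is contained in `V` and `s` maps it to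
its prolongation over `(F, δ)`. -/
def IsDSubvariety {F : Type*} [Field F] [Differential F] [Algebra F K]
    (X : DVariety k K n) (W : AffineVariety F K (Fin n)) : Prop :=
  ∃ h : W.points ⊆ X.V.points,
    ∀ (w : Fin n → K) (hw : w ∈ W.points), (X.s ⟨w, h hw⟩).1 ∈ W.prolongation.points

/-- `a` is a `D`-point of `(V, s)`: `a ∈ V(K)` and `{a}` is a `D`-subvariety of `(V, s)`
over `(K, δ)`. -/
def IsDPoint [Differential K] (X : DVariety k K n) (a : Fin n → K) : Prop :=
  X.IsDSubvariety (AffineVariety.point a)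

/-- `a` is a generic `D`-point of `(V, s)` over `k`: a `D`-point contained in no proper subvariety
of `V` over `k`, that is, with Zariski locus `V` over `k`. -/
def IsGenericDPoint [Differential K] (X : DVariety k K n) (a : Fin n → K) : Prop :=
  X.IsDPoint a ∧
    ∀ W : AffineVariety k K (Fin n), W.points ⊆ X.V.points → a ∈ W.points →
      W.points = X.V.points

/-- `q ∈ S(k)` is the generic type of `(V, s)` over `k`: the complete type asserting that `x` is a
generic `D`-point of `(V, s)` over `k`, i.e. its realisations are exactly these points. -/
def IsGenericType [Differential K] (X : DVariety k K n) (q : TypeOver (params k K) n) : Prop :=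
  ∀ b : Fin n → K, Realizes b q ↔ X.IsGenericDPoint b

end DVariety

end Varieties

end DCF

end

/-!
The type of a finite dimensional tuple `a` is a matter of algebra once it is replaced by an
interdefinable tuple `b` with `δ b = s(b)` for polynomials `s` over `k`.

*Finding `b`.* If the transcendence degrees of the jets `(a, …, δ^ℓ a)` over `k` are constant from
`ℓ = N` on, then `δ^(N+1) a` is algebraic over `k(a, …, δ^N a)`, and differentiating minimal
polynomials shows that the field generated by the jet of order `N + 1` is closed under `δ`
(`exists_deriv_jet_mem_adjoin`). Adjoining to the jet the inverse of a common denominator makes the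
derivatives polynomial (`exists_deriv_eq_aeval`). The vector field `s` is tangent to the Zariski locus
of `b` because the equations of the prolongation hold at the generic point `b`; this is the
`D`-variety `DVariety.ofTuple`. The definable closure is a subfield closed under `δ`, so `a` and `b`
are interdefinable (`dcl_union_range_eq`).

*Its generic type is `tp(b/k)`.* A generic `D`-point is a solution of `δ v = s(v)` with the same
polynomial equations over `k` as `b`, so it has the same quantifier-free type, as on such points every
term is a polynomial. It remains to eliminate quantifiers. This is a back-and-forth argument
(`QfEquiv.realize_iff`) with extension step `QfEquiv.exists_extension`: by saturation it is enough to
solve finitely many equations and inequations at a time, and by existential closedness to solve them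
in some differential domain extending `K`. That domain amalgamates two copies of `K` over a common
differential subring (`exists_amalgam`). Embed the two copies as rings in a field `L` over the
subring; the Taylor morphisms `x ↦ ∑ δⁿ(x) / n! Xⁿ` then map both, compatibly with the derivations,
to the differential domain `L⟦X⟧`.

*An arbitrary realisation `a'` of the type of `a`* is treated by the extension step again, which gives
`b'` with `(a', b')` equivalent to `(a, b)`.
-/

noncomputable section

namespace DCF

/-! ### Amalgamation of differential fields -/

section Taylor

/-- The differential ring given by a derivation, linear over any base ring. -/
abbrev differentialOfDerivation {S R : Type*} [CommRing S] [CommRing R] [Algebra S R]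
    (d : Derivation S R R) : Differential R :=
  ⟨Derivation.mk' d.toLinearMap.toAddMonoidHom.toIntLinearMap d.leibniz⟩

variable {K L : Type u} [CommRing K] [Differential K] [Field L]

/-- Formal power series over a field form a differential ring, with derivation `d/dX`. -/
abbrev powerSeriesDifferential (L : Type u) [Field L] : Differential (PowerSeries L) :=
  differentialOfDerivation (PowerSeries.derivative L)

/-- The coefficients of the Taylor series `∑ f (δⁿ x) / n! Xⁿ`. -/
def taylorFun (f : K →+* L) (x : K) : PowerSeries L :=
  PowerSeries.mk fun n => f ((fun y : K => Differential.deriv y)^[n] x) * (n.factorial : L)⁻¹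

variable (f : K →+* L)

lemma taylorFun_add (x y : K) : taylorFun f (x + y) = taylorFun f x + taylorFun f y := by
  have h : ∀ (n : ℕ) (x y : K), (fun y : K => Differential.deriv y)^[n] (x + y) =
      (fun y : K => Differential.deriv y)^[n] x + (fun y : K => Differential.deriv y)^[n] y := by
    intro n
    induction n with
    | zero => simp
    | succ n ih => intro x y; simp [Function.iterate_succ_apply, ih]
  ext n
  simp [taylorFun, h, add_mul]

variable [CharZero L]

lemma derivative_taylorFun (x : K) :
    PowerSeries.derivative L (taylorFun f x) = taylorFun f (Differential.deriv x) := by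
  ext n
  have h : ((n : L) + 1) ≠ 0 := by exact_mod_cast n.succ_ne_zero
  have h' : (n.factorial : L) ≠ 0 := by exact_mod_cast n.factorial_ne_zero
  rw [PowerSeries.coeff_derivative, taylorFun, taylorFun, PowerSeries.coeff_mk,
    PowerSeries.coeff_mk, Function.iterate_succ_apply, Nat.factorial_succ]
  push_cast
  field_simp

lemma taylorFun_mul (x y : K) : taylorFun f (x * y) = taylorFun f x * taylorFun f y := by
  ext n
  induction n generalizing x y with
  | zero => simp [taylorFun, PowerSeries.coeff_mul]
  | succ n ih =>
    -- both sides satisfy the same first order recursion, by the Leibniz rule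
    have h : ((n : L) + 1) ≠ 0 := by exact_mod_cast n.succ_ne_zero
    apply mul_right_cancel₀ h
    rw [← PowerSeries.coeff_derivative, ← PowerSeries.coeff_derivative, derivative_taylorFun,
      Derivation.leibniz, Derivation.leibniz, taylorFun_add, derivative_taylorFun,
      derivative_taylorFun]
    simp only [smul_eq_mul, map_add, ih]

/-- The Taylor morphism `x ↦ ∑ f (δⁿ x) / n! Xⁿ` attached to a ring homomorphism `f` into a field of
characteristic zero. It turns the derivation of `K` into `d/dX`. -/
def taylor : K →+* PowerSeries L :=
  RingHom.mk' ⟨⟨taylorFun f, by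
    ext n
    have h : ∀ n : ℕ, (fun y : K => Differential.deriv y)^[n + 1] 1 = 0 := by
      intro n
      induction n with
      | zero => simp
      | succ n ih => rw [Function.iterate_succ_apply', ih]; simp
    cases n with
    | zero => simp [taylorFun]
    | succ n => rw [taylorFun, PowerSeries.coeff_mk, h]; simp [PowerSeries.coeff_one]⟩,
    taylorFun_mul f⟩ (taylorFun_add f)

end Taylor

/-- Two extensions of a field embed over it in a common field. -/
lemma exists_common_extension (F K₁ K₂ : Type u) [Field F] [Field K₁] [Field K₂] [Algebra F K₁]
    [Algebra F K₂] : ∃ (L : Type u) (_ : Field L) (f₁ : K₁ →+* L) (f₂ : K₂ →+* L),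
      ∀ x : F, f₁ (algebraMap F K₁ x) = f₂ (algebraMap F K₂ x) := by
  obtain ⟨I, hI⟩ := Ideal.exists_maximal (TensorProduct F K₁ K₂)
  refine ⟨_, Ideal.Quotient.field I,
    (Ideal.Quotient.mk I).comp (Algebra.TensorProduct.includeLeft (R := F) (S := F)).toRingHom,
    (Ideal.Quotient.mk I).comp (Algebra.TensorProduct.includeRight (R := F)).toRingHom, ?_⟩
  intro x
  simp only [AlgHom.toRingHom_eq_coe, RingHom.coe_comp, RingHom.coe_coe, Function.comp_apply,
    AlgHom.commutes]

/-- Amalgamation: a differential field of characteristic zero and an embedding into it of a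
differential subring `S` can be completed to a commutative square of differential homomorphisms into
a differential domain. The domain is a power series ring over a common extension `L` of two copies of
the field, and the homomorphisms are Taylor morphisms; they agree on `S` since `S` is closed under
the derivation. -/
theorem exists_amalgam {K : Type u} [Field K] [Differential K] [CharZero K] (S : Subring K)
    (φ : S →+* K) (hinj : Function.Injective φ)
    (hφ : ∀ s : S, ∃ s' : S, (s' : K) = Differential.deriv (s : K) ∧
      φ s' = Differential.deriv (φ s)) :
    ∃ (R : Type u) (_ : CommRing R) (_ : IsDomain R) (_ : CharZero R) (_ : Differential R)
      (T₁ T₂ : K →+* R), (∀ x, T₁ (Differential.deriv x) = Differential.deriv (T₁ x)) ∧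
      (∀ x, T₂ (Differential.deriv x) = Differential.deriv (T₂ x)) ∧
      ∀ s : S, T₁ (s : K) = T₂ (φ s) := by
  let a₁ : Algebra (FractionRing S) K :=
    (IsFractionRing.lift (A := S) (g := S.subtype) S.subtype_injective).toAlgebra
  let a₂ : Algebra (FractionRing S) K := (IsFractionRing.lift (A := S) (g := φ) hinj).toAlgebra
  obtain ⟨L, _, f₁, f₂, h⟩ :=
    @exists_common_extension (FractionRing S) K K _ _ _ a₁ a₂
  have : CharZero L := charZero_of_injective_ringHom f₁.injective
  have h' : ∀ s : S, f₁ (s : K) = f₂ (φ s) := by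
    intro s
    have := h (algebraMap S _ s)
    rw [@RingHom.algebraMap_toAlgebra _ _ _ _, @RingHom.algebraMap_toAlgebra _ _ _ _,
      IsFractionRing.lift_algebraMap, IsFractionRing.lift_algebraMap] at this
    exact this
  let _ := powerSeriesDifferential L
  refine ⟨PowerSeries L, inferInstance, inferInstance,
    charZero_of_injective_ringHom (PowerSeries.C_injective (R := L)), inferInstance,
    taylor f₁, taylor f₂, fun x => (derivative_taylorFun f₁ x).symm,
    fun x => (derivative_taylorFun f₂ x).symm, ?_⟩
  have hn : ∀ (n : ℕ) (s : S), ∃ s' : S,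
      (s' : K) = (fun y : K => Differential.deriv y)^[n] (s : K) ∧
      φ s' = (fun y : K => Differential.deriv y)^[n] (φ s) := by
    intro n
    induction n with
    | zero => exact fun s => ⟨s, rfl, rfl⟩
    | succ n ih =>
      intro s
      obtain ⟨s₁, h₁, h₂⟩ := ih s
      obtain ⟨s₂, h₃, h₄⟩ := hφ s₁
      exact ⟨s₂, by rw [h₃, h₁, Function.iterate_succ_apply'],
        by rw [h₄, h₂, Function.iterate_succ_apply']⟩
  intro s
  change taylorFun f₁ s = taylorFun f₂ (φ s)
  ext n
  obtain ⟨s', h₁, h₂⟩ := hn n s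
  simp only [taylorFun, PowerSeries.coeff_mk]
  rw [← h₁, ← h₂, h']

/-! ### Realising small partial types -/

section Saturation

variable {K : Type u} [CommRing K] [Differential K] [Nontrivial K]

/-- In a saturated model a finitely satisfiable set of formulas over a small parameter set is
satisfiable. -/
theorem IsSaturated.exists_realize {κ : Cardinal.{u}} (hsat : IsSaturated K κ) {B : Set K}
    (hB : #B < κ) {n : ℕ} (Ψ : Set (dRing.Formula (B ⊕ Fin n)))
    (hfin : ∀ S : Finset (dRing.Formula (B ⊕ Fin n)), (S : Set _) ⊆ Ψ →
      ∃ y : Fin n → K, ∀ φ ∈ S, φ.Realize (Sum.elim (↑) y)) :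
    ∃ y : Fin n → K, ∀ φ ∈ Ψ, φ.Realize (Sum.elim (↑) y) := by
  classical
  let g : dRing.Formula (B ⊕ Fin n) → dRing[[B]][[Fin n]].Sentence := fun φ =>
    Formula.equivSentence (BoundedFormula.constantsVarsEquiv.symm φ : dRing[[B]].Formula (Fin n))
  have hg : ∀ (φ : dRing.Formula (B ⊕ Fin n)) (y : Fin n → K),
      Formula.Realize (BoundedFormula.constantsVarsEquiv.symm φ : dRing[[B]].Formula (Fin n)) y ↔
        φ.Realize (Sum.elim (↑) y) := by
    intro φ y
    have := BoundedFormula.realize_constantsVarsEquiv (L := dRing) (M := K) (α := B)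
      (φ := BoundedFormula.constantsVarsEquiv.symm φ) (v := y) (xs := default)
    rw [Equiv.apply_symm_apply] at this
    exact this.symm
  have hsatis : ((dRing[[B]].lhomWithConstants (Fin n)).onTheory (dRing[[B]].completeTheory K) ∪
      g '' Ψ).IsSatisfiable := by
    rw [Theory.isSatisfiable_iff_isFinitelySatisfiable]
    intro T hT
    obtain ⟨S, hS, hST⟩ := Finset.subset_set_image_iff.1
      (show ((T.filter (· ∈ g '' Ψ) : Finset _) : Set _) ⊆ g '' Ψ by
        intro φ hφ; exact (Finset.mem_filter.1 hφ).2)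
    obtain ⟨y, hy⟩ := hfin S hS
    let _ : (constantsOn (Fin n)).Structure K := constantsOn.structure y
    have : K ⊨ (T : dRing[[B]][[Fin n]].Theory) := by
      refine ⟨fun φ hφ => ?_⟩
      rcases hT hφ with h | h
      · have := (LHom.onTheory_model (M := K) (dRing[[B]].lhomWithConstants (Fin n))
          (dRing[[B]].completeTheory K)).2 inferInstance
        exact this.realize_of_mem φ h
      · have : φ ∈ S.image g := by rw [hST]; exact Finset.mem_filter.2 ⟨hφ, h⟩
        obtain ⟨ψ, hψ, rfl⟩ := Finset.mem_image.1 this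
        rw [Formula.realize_equivSentence]
        exact (hg ψ y).2 (hy ψ hψ)
    exact Theory.Model.isSatisfiable K
  have hne : {p : TypeOver B n | g '' Ψ ⊆ ↑p}.Nonempty := by
    rw [Set.nonempty_iff_ne_empty]
    exact fun h => (Theory.CompleteType.setOfPred_subset_eq_empty_iff _).1 h hsatis
  obtain ⟨p, hp⟩ := hne
  obtain ⟨y, hy⟩ := hsat B hB n p
  refine ⟨y, fun φ hφ => ?_⟩
  rw [← hg, ← Theory.CompleteType.formula_mem_typeOf (T := dRing[[B]].completeTheory K)]
  rw [Realizes] at hy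
  rw [hy]
  exact hp ⟨φ, hφ, rfl⟩

end Saturation

/-! ### Terms of the language of differential rings -/

section Terms

variable {α : Type*}

/-- The term `0`. -/
def zeroTerm : dRing.Term α := Term.func (DRingFunc.zero : dRing.Functions 0) ![]

/-- The term `1`. -/
def oneTerm : dRing.Term α := Term.func (DRingFunc.one : dRing.Functions 0) ![]

/-- The term `-t`. -/
def negTerm (t : dRing.Term α) : dRing.Term α :=
  Term.func (DRingFunc.neg : dRing.Functions 1) ![t]

/-- The term `t₁ + t₂`. -/
def addTerm (t₁ t₂ : dRing.Term α) : dRing.Term α :=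
  Term.func (DRingFunc.add : dRing.Functions 2) ![t₁, t₂]

/-- The term `t₁ * t₂`. -/
def mulTerm (t₁ t₂ : dRing.Term α) : dRing.Term α :=
  Term.func (DRingFunc.mul : dRing.Functions 2) ![t₁, t₂]

/-- The term `δ t`. -/
def derTerm (t : dRing.Term α) : dRing.Term α :=
  Term.func (DRingFunc.der : dRing.Functions 1) ![t]

variable {R : Type*} [CommRing R] [Differential R] (v : α → R) (t t₁ t₂ : dRing.Term α)

@[simp] lemma realize_zeroTerm : (zeroTerm : dRing.Term α).realize v = 0 := rfl

@[simp] lemma realize_oneTerm : (oneTerm : dRing.Term α).realize v = 1 := rfl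

@[simp] lemma realize_negTerm : (negTerm t).realize v = -t.realize v := rfl

@[simp] lemma realize_addTerm : (addTerm t₁ t₂).realize v = t₁.realize v + t₂.realize v := rfl

@[simp] lemma realize_mulTerm : (mulTerm t₁ t₂).realize v = t₁.realize v * t₂.realize v := rfl

@[simp] lemma realize_derTerm : (derTerm t).realize v = Differential.deriv (t.realize v) := rfl

@[simp] lemma realize_iterate_derTerm (i : ℕ) :
    (derTerm^[i] t).realize v = (fun y : R => Differential.deriv y)^[i] (t.realize v) := by
  induction i with
  | zero => rfl
  | succ i ih => rw [Function.iterate_succ_apply', Function.iterate_succ_apply', realize_derTerm, ih]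

end Terms

/-! ### Equality of quantifier-free types -/

section QfEquiv

/-- A differential homomorphism from a field to a nontrivial ring, as an embedding of structures. -/
def embeddingOfRingHom {K R : Type*} [Field K] [Differential K] [CommRing R] [Nontrivial R]
    [Differential R] (T : K →+* R)
    (hT : ∀ x, T (Differential.deriv x) = Differential.deriv (T x)) : K ↪[dRing] R where
  toFun := T
  inj' := T.injective
  map_fun' := by
    intro n f x
    cases f
    · exact map_zero T
    · exact map_one T
    · exact map_neg T _
    · exact map_add T _ _
    · exact map_mul T _ _
    · exact hT _
  map_rel' := fun r => Empty.elim r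

lemma IsLiteral.isQF {α : Type*} {φ : dRing.Formula α} (h : IsLiteral φ) :
    BoundedFormula.IsQF φ := by
  rcases h with h | ⟨ψ, h, rfl⟩
  · exact h.isQF
  · exact h.isQF.not

lemma IsLiteral.relabel {α β : Type*} {φ : dRing.Formula α} (h : IsLiteral φ) (g : α → β) :
    IsLiteral (φ.relabel g) := by
  rcases h with h | ⟨ψ, h, rfl⟩
  · exact Or.inl (h.relabel _)
  · exact Or.inr ⟨ψ.relabel g, h.relabel _, rfl⟩

lemma IsLiteral.realize_ringHom {K R α : Type*} [Field K] [Differential K] [CommRing R]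
    [Nontrivial R] [Differential R] (T : K →+* R)
    (hT : ∀ x, T (Differential.deriv x) = Differential.deriv (T x)) {φ : dRing.Formula α}
    (h : IsLiteral φ) (v : α → K) : φ.Realize (T ∘ v) ↔ φ.Realize v := by
  have := h.isQF.realize_embedding (embeddingOfRingHom T hT) (v := v) (xs := default)
  rwa [Subsingleton.elim (embeddingOfRingHom T hT ∘ default) default] at this

variable {K : Type u} [Field K] [Differential K]

/-- `v` and `w` have the same quantifier-free type over `A`: they satisfy the same equations between
terms of the language of differential rings with parameters in `A`. Parameters are treated as
variables with a fixed value. -/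
def QfEquiv {α : Type*} (A : Set K) (v w : α → K) : Prop :=
  ∀ t₁ t₂ : dRing.Term (A ⊕ α),
    t₁.realize (Sum.elim (↑) v) = t₂.realize (Sum.elim (↑) v) ↔
      t₁.realize (Sum.elim (↑) w) = t₂.realize (Sum.elim (↑) w)

variable {A : Set K}

lemma QfEquiv.symm {α : Type*} {v w : α → K} (h : QfEquiv A v w) : QfEquiv A w v :=
  fun t₁ t₂ => (h t₁ t₂).symm

lemma QfEquiv.comp {α β : Type*} {v w : α → K} (h : QfEquiv A v w) (g : β → α) :
    QfEquiv A (v ∘ g) (w ∘ g) := by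
  intro t₁ t₂
  have := h (t₁.relabel (Sum.map id g)) (t₂.relabel (Sum.map id g))
  simpa only [Term.realize_relabel, Sum.elim_comp_map, Function.comp_id] using this

/-- If `v` and `w` have the same quantifier-free type over `A`, then the differential rings generated
by `A ∪ w` and by `A ∪ v` are isomorphic, and the resulting embeddings into `K` can be amalgamated. -/
theorem QfEquiv.exists_amalgam [CharZero K] {α : Type*} {v w : α → K} (h : QfEquiv A v w) :
    ∃ (R : Type u) (_ : CommRing R) (_ : IsDomain R) (_ : CharZero R) (_ : Differential R)
      (T₁ T₂ : K →+* R), (∀ x, T₁ (Differential.deriv x) = Differential.deriv (T₁ x)) ∧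
      (∀ x, T₂ (Differential.deriv x) = Differential.deriv (T₂ x)) ∧
      (∀ a ∈ A, T₁ a = T₂ a) ∧ ∀ i, T₁ (w i) = T₂ (v i) := by
  let ev (u : α → K) (t : dRing.Term (A ⊕ α)) : K := t.realize (Sum.elim (↑) u)
  have hev : ∀ {t₁ t₂}, ev w t₁ = ev w t₂ → ev v t₁ = ev v t₂ := fun {t₁ t₂} => (h t₁ t₂).2
  let S : Subring K :=
    { carrier := Set.range (ev w)
      mul_mem' := by rintro _ _ ⟨t₁, rfl⟩ ⟨t₂, rfl⟩; exact ⟨mulTerm t₁ t₂, realize_mulTerm ..⟩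
      one_mem' := ⟨oneTerm, realize_oneTerm _⟩
      add_mem' := by rintro _ _ ⟨t₁, rfl⟩ ⟨t₂, rfl⟩; exact ⟨addTerm t₁ t₂, realize_addTerm ..⟩
      zero_mem' := ⟨zeroTerm, realize_zeroTerm _⟩
      neg_mem' := by rintro _ ⟨t₁, rfl⟩; exact ⟨negTerm t₁, realize_negTerm ..⟩ }
  let c (s : S) : dRing.Term (A ⊕ α) := s.2.choose
  have hc : ∀ s, ev w (c s) = s := fun s => s.2.choose_spec
  have hc' : ∀ s : S, (c s).realize (Sum.elim (↑) w) = (s : K) := hc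
  have hcv : ∀ (s : S) t, ev w t = s → ev v (c s) = ev v t :=
    fun s t ht => hev ((hc s).trans ht.symm)
  let φ : S →+* K :=
    { toFun := fun s => ev v (c s)
      map_one' := (hcv _ oneTerm (realize_oneTerm _)).trans (realize_oneTerm _)
      map_zero' := (hcv _ zeroTerm (realize_zeroTerm _)).trans (realize_zeroTerm _)
      map_add' := fun s t =>
        (hcv _ (addTerm (c s) (c t)) ((realize_addTerm ..).trans (by rw [hc', hc']; rfl))).trans
          (realize_addTerm ..)
      map_mul' := fun s t =>
        (hcv _ (mulTerm (c s) (c t)) ((realize_mulTerm ..).trans (by rw [hc', hc']; rfl))).trans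
          (realize_mulTerm ..) }
  have hφ : ∀ (s : S) t, ev w t = s → φ s = ev v t := hcv
  have hinj : Function.Injective φ := by
    intro s t hst
    have := (h (c s) (c t)).1 hst
    exact Subtype.ext ((hc s).symm.trans (this.trans (hc t)))
  have hder : ∀ s, ev w (derTerm (c s)) = Differential.deriv (s : K) := fun s =>
    (realize_derTerm ..).trans (by rw [hc'])
  obtain ⟨R, i₁, i₂, i₃, i₄, T₁, T₂, hT₁, hT₂, hT⟩ := DCF.exists_amalgam S φ hinj (fun s =>
    ⟨⟨_, derTerm (c s), hder s⟩, rfl, (hφ _ (derTerm (c s)) (hder s)).trans (realize_derTerm ..)⟩)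
  refine ⟨R, i₁, i₂, i₃, i₄, T₁, T₂, hT₁, hT₂, fun a ha => ?_, fun i => ?_⟩
  · have := hT ⟨a, Term.var (Sum.inl ⟨a, ha⟩), rfl⟩
    rwa [hφ _ (Term.var (Sum.inl ⟨a, ha⟩)) rfl] at this
  · have := hT ⟨w i, Term.var (Sum.inr i), rfl⟩
    rwa [hφ _ (Term.var (Sum.inr i)) rfl] at this

/-- The extension step of the back-and-forth argument: a finite tuple `x` can be matched, keeping the
quantifier-free type. By saturation finitely many literals are to be solved at a time; they have a
solution in an amalgam of two copies of `K`, hence one in `K`. -/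
theorem QfEquiv.exists_extension (hK : IsDCF K) {κ : Cardinal.{u}} (hsat : IsSaturated K κ)
    {α : Type*} {v w : α → K} (hA : #(A ∪ Set.range w : Set K) < κ) (h : QfEquiv A v w)
    {n : ℕ} (x : Fin n → K) : ∃ y : Fin n → K, QfEquiv A (Sum.elim v x) (Sum.elim w y) := by
  have := hK.charZero
  obtain ⟨R, _, _, _, _, T₁, T₂, hT₁, hT₂, hTA, hT⟩ := h.exists_amalgam
  let B : Set K := A ∪ Set.range w
  -- the matching of variables: those of the tuple `v` become the parameters `w`
  let g : A ⊕ (α ⊕ Fin n) → B ⊕ Fin n :=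
    Sum.elim (fun a => Sum.inl ⟨a, Or.inl a.2⟩)
      (Sum.elim (fun i => Sum.inl ⟨w i, Or.inr ⟨i, rfl⟩⟩) Sum.inr)
  have hgK : ∀ y : Fin n → K,
      (Sum.elim (↑) y : B ⊕ Fin n → K) ∘ g = Sum.elim (↑) (Sum.elim w y) := by
    intro y; funext z; rcases z with a | i | j <;> rfl
  let Φ : Set (dRing.Formula (A ⊕ (α ⊕ Fin n))) :=
    {φ | IsLiteral φ ∧ φ.Realize (Sum.elim (↑) (Sum.elim v x))}
  obtain ⟨y, hy⟩ := hsat.exists_realize hA ((fun φ => φ.relabel g) '' Φ) (by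
    classical
    intro S hS
    let _ : Algebra K R := T₁.toAlgebra
    have : DifferentialAlgebra K R := ⟨fun a => (hT₁ a).symm⟩
    let e : B ⊕ Fin n → K ⊕ Fin n := Sum.map (↑) id
    obtain ⟨y, hy⟩ := hK.existentiallyClosed R T₁.injective n (S.image fun φ => φ.relabel e) (by
      intro φ hφ
      obtain ⟨ψ, hψ, rfl⟩ := Finset.mem_image.1 hφ
      obtain ⟨θ, hθ, rfl⟩ := hS hψ
      exact (hθ.1.relabel g).relabel e) ⟨T₂ ∘ x, by
        intro φ hφ
        obtain ⟨ψ, hψ, rfl⟩ := Finset.mem_image.1 hφ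
        obtain ⟨θ, hθ, rfl⟩ := hS hψ
        rw [Formula.realize_relabel, Formula.realize_relabel]
        have := (hθ.1.realize_ringHom T₂ hT₂ _).2 hθ.2
        convert this using 1
        funext z
        rcases z with a | i | j
        · exact hTA _ a.2
        · exact hT i
        · rfl⟩
    refine ⟨y, fun φ hφ => ?_⟩
    have := hy _ (Finset.mem_image_of_mem _ hφ)
    rw [Formula.realize_relabel] at this
    convert this using 1
    funext z
    rcases z with a | j <;> rfl)
  refine ⟨y, fun t₁ t₂ => ?_⟩
  have key : ∀ φ : dRing.Formula (A ⊕ (α ⊕ Fin n)), IsLiteral φ →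
      φ.Realize (Sum.elim (↑) (Sum.elim v x)) → φ.Realize (Sum.elim (↑) (Sum.elim w y)) := by
    intro φ hφ hr
    have := hy _ ⟨φ, ⟨hφ, hr⟩, rfl⟩
    rwa [Formula.realize_relabel, hgK] at this
  have hat : BoundedFormula.IsAtomic (Term.equal t₁ t₂) := BoundedFormula.IsAtomic.equal _ _
  constructor
  · intro ht
    simpa using key (Term.equal t₁ t₂) (Or.inl hat) (by simpa using ht)
  · intro ht
    by_contra hne
    have := key (∼(Term.equal t₁ t₂)) (Or.inr ⟨_, hat, rfl⟩) (by
      rw [Formula.realize_not]; simpa using hne)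
    rw [Formula.realize_not] at this
    exact this (by simpa using ht)

end QfEquiv

/-! ### Quantifier-free types determine types -/

section Types

variable {K : Type u} [Field K] [Differential K] {A : Set K}

/-- A term with constant symbols for the elements of `A`, as a term with parameters in `A`. -/
lemma exists_term_eq_realize {α : Type*} (t : dRing[[A]].Term α) :
    ∃ s : dRing.Term (A ⊕ α), ∀ v : α → K, s.realize (Sum.elim (↑) v) = t.realize v :=
  ⟨t.constantsToVars, fun _ => Term.realize_constantsToVars⟩

/-- Quantifier elimination, in semantic form: in a saturated differentially closed field tuples with
the same quantifier-free type satisfy the same formulas. The back-and-forth extension step handles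
quantifiers. -/
theorem QfEquiv.realize_iff (hK : IsDCF K) {κ : Cardinal.{u}} (hsat : IsSaturated K κ)
    (hκ : ℵ₀ ≤ κ) (hA : #A < κ) {α : Type} [Finite α] {n : ℕ}
    (φ : dRing[[A]].BoundedFormula α n) {v w : α → K} {x y : Fin n → K}
    (h : QfEquiv A (Sum.elim v x) (Sum.elim w y)) : φ.Realize v x ↔ φ.Realize w y := by
  have hcard : ∀ {n : ℕ} (w : α → K) (y : Fin n → K),
      #(A ∪ Set.range (Sum.elim w y) : Set K) < κ := fun w y =>
    (mk_union_le _ _).trans_lt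
      (add_lt_of_lt hκ hA ((lt_aleph0_of_finite _).trans_le hκ))
  have hsnoc : ∀ {n : ℕ} (v : α → K) (x : Fin n → K) (z : Fin 1 → K),
      Sum.elim v (Fin.snoc x (z 0) : Fin (n + 1) → K) =
        Sum.elim (Sum.elim v x) z ∘ Sum.elim (Sum.inl ∘ Sum.inl)
          (Fin.snoc (Sum.inl ∘ Sum.inr) (Sum.inr 0) : Fin (n + 1) → _) := by
    intro n v x z
    funext i
    rcases i with i | i
    · rfl
    · refine Fin.lastCases ?_ (fun i => ?_) i <;> simp
  -- one half of the quantifier step; the other half follows by symmetry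
  have step : ∀ {n : ℕ} {φ : dRing[[A]].BoundedFormula α (n + 1)} {v w : α → K} {x y : Fin n → K},
      (∀ {x y : Fin (n + 1) → K}, QfEquiv A (Sum.elim v x) (Sum.elim w y) →
        (φ.Realize v x ↔ φ.Realize w y)) →
      QfEquiv A (Sum.elim v x) (Sum.elim w y) →
      (∀ a, φ.Realize w (Fin.snoc y a)) → ∀ a, φ.Realize v (Fin.snoc x a) := by
    intro n φ v w x y ih h hw a
    obtain ⟨z, hz⟩ := h.exists_extension hK hsat (hcard w y) ![a]
    refine (ih (y := Fin.snoc y (z 0)) ?_).2 (hw _)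
    have := hz.comp (Sum.elim (Sum.inl ∘ Sum.inl)
          (Fin.snoc (Sum.inl ∘ Sum.inr) (Sum.inr 0) : Fin (n + 1) → _))
    rw [← hsnoc, ← hsnoc] at this
    exact this
  induction φ generalizing v w with
  | falsum => exact Iff.rfl
  | equal t₁ t₂ =>
    obtain ⟨s₁, h₁⟩ := exists_term_eq_realize t₁
    obtain ⟨s₂, h₂⟩ := exists_term_eq_realize t₂
    change t₁.realize _ = t₂.realize _ ↔ t₁.realize _ = t₂.realize _
    rw [← h₁, ← h₂, ← h₁, ← h₂]
    exact h s₁ s₂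
  | rel R ts => rcases R with R | R <;> exact isEmptyElim (α := Empty) (by cases R)
  | imp φ ψ ih₁ ih₂ => exact imp_congr (ih₁ h) (ih₂ h)
  | all φ ih =>
    exact ⟨fun hv => step (fun {x y} h' => ih h') h.symm hv, fun hw => step (fun {x y} h' => ih h') h hw⟩

/-- Tuples with the same quantifier-free type over `A` have the same type over `A`. -/
theorem QfEquiv.typeOf_eq (hK : IsDCF K) {κ : Cardinal.{u}} (hsat : IsSaturated K κ)
    (hκ : ℵ₀ ≤ κ) (hA : #A < κ) {n : ℕ} {v w : Fin n → K} (h : QfEquiv A v w) :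
    (dRing[[A]].completeTheory K).typeOf v = (dRing[[A]].completeTheory K).typeOf w := by
  refine SetLike.ext fun φ => ?_
  rw [Theory.CompleteType.mem_typeOf, Theory.CompleteType.mem_typeOf]
  refine QfEquiv.realize_iff hK hsat hκ hA _ ?_
  have := h.comp (Sum.elim id (default : Fin 0 → Fin n))
  convert this using 1 <;>
  · funext i
    rcases i with i | i
    · rfl
    · exact i.elim0

/-- Tuples with the same type over `A` have the same quantifier-free type over `A`. -/
theorem qfEquiv_of_typeOf_eq {n : ℕ} {v w : Fin n → K}
    (h : (dRing[[A]].completeTheory K).typeOf v = (dRing[[A]].completeTheory K).typeOf w) :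
    QfEquiv A v w := by
  intro t₁ t₂
  have hr : ∀ (t : dRing.Term (A ⊕ Fin n)) (u : Fin n → K),
      t.varsToConstants.realize u = t.realize (Sum.elim (↑) u) := fun t u =>
    Term.realize_varsToConstants
  have key : ∀ u : Fin n → K,
      Formula.equivSentence (Term.equal t₁.varsToConstants t₂.varsToConstants) ∈
        (dRing[[A]].completeTheory K).typeOf u ↔
      t₁.realize (Sum.elim (↑) u) = t₂.realize (Sum.elim (↑) u) := by
    intro u
    rw [Theory.CompleteType.formula_mem_typeOf, Formula.realize_equal, hr, hr]
  rw [← key, ← key, h]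

end Types

/-! ### Definable closure -/

section Dcl

variable {K : Type u} [Field K] [Differential K] {C : Set K}

/-- An element defined by a formula over parameters in `dcl C` is in `dcl C`. -/
theorem mem_dcl_of_formula {β : Type*} [Finite β] {d : β → K} (hd : ∀ i, d i ∈ dcl C) {c : K}
    (φ : dRing.Formula (β ⊕ Fin 1)) (hφ : ∀ z : Fin 1 → K, φ.Realize (Sum.elim d z) ↔ z 0 = c) :
    c ∈ dcl C := by
  have h₁ : C.Definable dRing {u : β ⊕ Fin 1 → K | φ.Realize u} :=
    Set.Definable.mono (Set.empty_definable_iff.2 ⟨φ, rfl⟩) (Set.empty_subset C)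
  have h₂ : ∀ i, C.Definable dRing {u : β ⊕ Fin 1 → K | u (Sum.inl i) = d i} := fun i =>
    (show C.Definable dRing {x : Fin 1 → K | x 0 ∈ ({d i} : Set K)} from hd i).preimage_comp
      (fun _ : Fin 1 => (Sum.inl i : β ⊕ Fin 1))
  have h₃ := (h₁.inter (Set.definable_iInter_of_finite h₂)).image_comp (Sum.inr : Fin 1 → β ⊕ Fin 1)
  change C.Definable dRing {x : Fin 1 → K | x 0 ∈ ({c} : Set K)}
  convert h₃ using 1
  ext z
  simp only [Set.mem_image, Set.mem_inter_iff, Set.mem_iInter, Set.mem_ofPred_eq,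
    Set.mem_singleton_iff]
  constructor
  · intro hz
    exact ⟨Sum.elim d z, ⟨(hφ z).2 hz, fun _ => rfl⟩, rfl⟩
  · rintro ⟨u, ⟨hu, hd⟩, rfl⟩
    refine (hφ _).1 ?_
    convert hu using 1
    funext i
    rcases i with i | i
    · exact (hd i).symm
    · rfl

lemma subset_dcl : C ⊆ dcl C := fun c hc => by
  change C.Definable dRing {x : Fin 1 → K | x 0 ∈ ({c} : Set K)}
  exact Set.Definable.singleton_of_mem dRing hc

lemma dcl_subset_dcl {B : Set K} (h : B ⊆ dcl C) : dcl B ⊆ dcl C := by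
  intro c hc
  obtain ⟨B₀, hB₀, hc⟩ := Set.definable_iff_finitely_definable.1
    (show B.Definable dRing {x : Fin 1 → K | x 0 ∈ ({c} : Set K)} from hc)
  obtain ⟨φ, hφ⟩ := Set.definable_iff_exists_formula_sum.1 hc
  refine mem_dcl_of_formula (d := fun i : (B₀ : Set K) => (i : K)) (fun i => h (hB₀ i.2)) φ
    fun z => ?_
  have := Set.ext_iff.1 hφ z
  simpa only [Set.mem_ofPred_eq, Set.mem_singleton_iff] using this.symm

lemma mem_dcl_of_term {n : ℕ} {d : Fin n → K} (hd : ∀ i, d i ∈ dcl C) (t : dRing.Term (Fin n)) :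
    t.realize d ∈ dcl C := by
  refine mem_dcl_of_formula hd
    (Term.equal (Term.var (Sum.inr 0)) (t.relabel Sum.inl)) fun z => ?_
  rw [Formula.realize_equal, Term.realize_relabel]
  rfl

variable (C) in
/-- The definable closure is a subfield. -/
def dclSubfield : Subfield K where
  carrier := dcl C
  mul_mem' {a b} ha hb := by
    simpa using mem_dcl_of_term (d := ![a, b]) (by simp [Fin.forall_fin_two, ha, hb])
      (mulTerm (Term.var 0) (Term.var 1))
  one_mem' := mem_dcl_of_term (d := ![]) (fun i => i.elim0) oneTerm
  add_mem' {a b} ha hb := by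
    simpa using mem_dcl_of_term (d := ![a, b]) (by simp [Fin.forall_fin_two, ha, hb])
      (addTerm (Term.var 0) (Term.var 1))
  zero_mem' := mem_dcl_of_term (d := ![]) (fun i => i.elim0) zeroTerm
  neg_mem' {a} ha := by
    simpa using mem_dcl_of_term (d := ![a]) (by simp [ha]) (negTerm (Term.var 0))
  inv_mem' a ha := by
    by_cases h0 : a = 0
    · subst h0; rwa [inv_zero]
    refine mem_dcl_of_formula (d := ![a]) (by simp [ha])
      (Term.equal (mulTerm (Term.var (Sum.inl 0)) (Term.var (Sum.inr 0))) oneTerm) fun z => ?_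
    rw [Formula.realize_equal]
    simp only [realize_mulTerm, Term.realize_var, realize_oneTerm, Sum.elim_inl, Sum.elim_inr,
      Matrix.cons_val_zero]
    rw [mul_comm, mul_eq_one_iff_eq_inv₀ h0]

lemma iterate_deriv_mem_dcl {a : K} (ha : a ∈ dcl C) (i : ℕ) :
    (fun y : K => Differential.deriv y)^[i] a ∈ dcl C := by
  simpa using mem_dcl_of_term (d := ![a]) (by simp [ha]) (derTerm^[i] (Term.var 0))

end Dcl

/-! ### Finitely generated differential algebras -/

section Algebra

variable {k : Type v} {K : Type u} [Field k] [Differential k] [Field K] [Differential K]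
  [Algebra k K] [DifferentialAlgebra k K]

lemma deriv_mem_of_mem_algebraAdjoin (R : Subalgebra k K) {S : Set K} (hS : S ⊆ R)
    (hD : ∀ s ∈ S, Differential.deriv s ∈ R) {x : K} (hx : x ∈ Algebra.adjoin k S) :
    Differential.deriv x ∈ R := by
  have hle : Algebra.adjoin k S ≤ R := Algebra.adjoin_le hS
  induction hx using Algebra.adjoin_induction with
  | mem x hx => exact hD x hx
  | algebraMap r => rw [deriv_algebraMap]; exact R.algebraMap_mem _
  | add x y hx hy hx' hy' => rw [map_add]; exact add_mem hx' hy'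
  | mul x y hx hy hx' hy' =>
    rw [Derivation.leibniz]
    exact add_mem (mul_mem (hle hx) hy') (mul_mem (hle hy) hx')

lemma deriv_mem_of_mem_adjoin (F : IntermediateField k K) {S : Set K} (hS : S ⊆ F)
    (hD : ∀ s ∈ S, Differential.deriv s ∈ F) {x : K} (hx : x ∈ IntermediateField.adjoin k S) :
    Differential.deriv x ∈ F := by
  have hle : IntermediateField.adjoin k S ≤ F := IntermediateField.adjoin_le_iff.2 hS
  induction hx using IntermediateField.adjoin_induction with
  | mem x hx => exact hD x hx
  | algebraMap r => rw [deriv_algebraMap]; exact F.algebraMap_mem _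
  | add x y hx hy hx' hy' => rw [map_add]; exact add_mem hx' hy'
  | inv x hx hx' =>
    rw [Derivation.leibniz_inv]
    exact mul_mem (neg_mem (pow_mem (inv_mem (hle hx)) 2)) hx'
  | mul x y hx hy hx' hy' =>
    rw [Derivation.leibniz]
    exact add_mem (mul_mem (hle hx) hy') (mul_mem (hle hy) hx')

omit [Differential k] [DifferentialAlgebra k K] in
/-- If `x` is algebraic over `E`, then `δ x` is a rational function of `x` over the field generated by
`E` and `δ E`: differentiate the minimal polynomial. -/
lemma deriv_mem_of_isAlgebraic [CharZero k] {E F : IntermediateField k K} (hEF : E ≤ F)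
    (hD : ∀ x ∈ E, Differential.deriv x ∈ F) {x : K} (hx : x ∈ F) (halg : IsAlgebraic E x) :
    Differential.deriv x ∈ F := by
  have : CharZero E := charZero_of_injective_algebraMap (algebraMap k E).injective
  have hint : IsIntegral E x := halg.isIntegral
  have hsep := (minpoly.irreducible hint).separable
  have hne := hsep.aeval_derivative_ne_zero (minpoly.aeval E x)
  set P : Polynomial K := (minpoly E x).map (algebraMap E K) with hP
  have heval := Differential.deriv_aeval_eq x P
  have h0 : Polynomial.aeval x P = 0 := by
    rw [hP, Polynomial.aeval_map_algebraMap, minpoly.aeval]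
  have h1 : Polynomial.aeval x P.derivative ≠ 0 := by
    rwa [hP, Polynomial.derivative_map, Polynomial.aeval_map_algebraMap]
  have hmem : ∀ Q : Polynomial K, (∀ i, Q.coeff i ∈ F) → Polynomial.aeval x Q ∈ F := by
    intro Q hQ
    rw [Polynomial.aeval_eq_sum_range]
    exact sum_mem fun i _ => mul_mem (hQ i) (pow_mem hx i)
  have hc : ∀ i, P.coeff i ∈ E := fun i => by
    rw [hP, Polynomial.coeff_map]; exact ((minpoly E x).coeff i).2
  have h2 : Polynomial.aeval x (Differential.mapCoeffs P) ∈ F := hmem _ fun i => by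
    rw [Differential.coeff_mapCoeffs]; exact hD _ (hc i)
  have h3 : Polynomial.aeval x P.derivative ∈ F := hmem _ fun i => by
    rw [Polynomial.coeff_derivative]
    exact mul_mem (hEF (hc _)) (add_mem (natCast_mem F i) (one_mem F))
  rw [h0, map_zero] at heval
  have : Differential.deriv x =
      -Polynomial.aeval x (Differential.mapCoeffs P) / Polynomial.aeval x P.derivative := by
    rw [eq_div_iff h1]; linear_combination -heval
  rw [this]
  exact div_mem (neg_mem h2) h3

omit [Differential k] [Differential K] [DifferentialAlgebra k K] in
/-- An extension of fields of equal finite transcendence degree over `k` is algebraic. -/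
lemma isAlgebraic_of_trdeg_eq {E F : IntermediateField k K} (hEF : E ≤ F)
    (hfin : Algebra.trdeg k E < ℵ₀) (h : Algebra.trdeg k F = Algebra.trdeg k E) {x : K}
    (hx : x ∈ F) : IsAlgebraic E x := by
  let _ : Algebra E F := (IntermediateField.inclusion hEF).toAlgebra
  have : IsScalarTower k E F := IsScalarTower.of_algebraMap_eq fun _ => rfl
  have : IsScalarTower E F K := IsScalarTower.of_algebraMap_eq fun _ => rfl
  have : FaithfulSMul E F :=
    (faithfulSMul_iff_algebraMap_injective E F).2 (IntermediateField.inclusion hEF).injective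
  have hadd := trdeg_add_eq k E (A := F)
  rw [h] at hadd
  have h0 : Algebra.trdeg E F = 0 :=
    Cardinal.eq_of_add_eq_add_left (hadd.trans (add_zero _).symm) hfin
  have : Algebra.IsAlgebraic E F := trdeg_eq_zero_iff.1 h0
  exact (this.isAlgebraic (⟨x, hx⟩ : F)).algebraMap (A := K)

omit [Differential k] [Differential K] [DifferentialAlgebra k K] in
lemma trdeg_adjoin_lt_aleph0 {S : Set K} (hS : S.Finite) :
    Algebra.trdeg k (IntermediateField.adjoin k S) < ℵ₀ := by
  have : Algebra.EssFiniteType k (IntermediateField.adjoin k S) :=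
    IntermediateField.essFiniteType_iff.2 (IntermediateField.fg_adjoin_of_finite hS)
  exact trdeg_lt_aleph0 k (IntermediateField.adjoin k S)

/-- The jet `(δⁱ aⱼ)`, `i < M`, of the tuple `a`. -/
def jet {m : ℕ} (M : ℕ) (a : Fin m → K) (x : Fin M × Fin m) : K :=
  (fun y : K => Differential.deriv y)^[x.1] (a x.2)

/-- The field generated by a sufficiently long jet of a finite dimensional tuple is closed under the
derivation. -/
theorem exists_deriv_jet_mem_adjoin [CharZero k] {m : ℕ} (a : Fin m → K) {N : ℕ}
    (h : ∀ ℓ ≥ N, dim k a ℓ = dim k a N) (x : Fin (N + 2) × Fin m) :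
    Differential.deriv (jet (N + 2) a x) ∈
      IntermediateField.adjoin k (Set.range (jet (N + 2) a)) := by
  let S (ℓ : ℕ) : Set K := {x : K | ∃ i ≤ ℓ, ∃ j, x = (fun y : K => Differential.deriv y)^[i] (a j)}
  have hS : ∀ ℓ, S ℓ = Set.range (jet (ℓ + 1) a) := by
    intro ℓ
    ext y
    constructor
    · rintro ⟨i, hi, j, rfl⟩
      exact ⟨(⟨i, Nat.lt_succ_of_le hi⟩, j), rfl⟩
    · rintro ⟨⟨i, j⟩, rfl⟩
      exact ⟨i, Nat.le_of_lt_succ i.2, j, rfl⟩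
  have hdim : ∀ ℓ, dim k a ℓ = Algebra.trdeg k (IntermediateField.adjoin k (S ℓ)) := fun _ => rfl
  have hmono : S N ⊆ S (N + 1) := fun y ⟨i, hi, hy⟩ => ⟨i, hi.trans N.le_succ, hy⟩
  have hle := IntermediateField.adjoin.mono k _ _ hmono
  have hsub := IntermediateField.subset_adjoin k (S (N + 1))
  rw [← hS (N + 1)]
  have hstep : ∀ i ≤ N, ∀ j,
      Differential.deriv ((fun y : K => Differential.deriv y)^[i] (a j)) ∈ S (N + 1) :=
    fun i hi j => ⟨i + 1, Nat.succ_le_succ hi, j, by rw [Function.iterate_succ_apply']⟩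
  obtain ⟨i, j⟩ := x
  rcases Nat.lt_or_ge i (N + 1) with hi | hi
  · exact hsub (hstep i (Nat.le_of_lt_succ hi) j)
  · have hx : jet (N + 2) a (i, j) ∈ IntermediateField.adjoin k (S (N + 1)) :=
      hsub ⟨i, Nat.le_of_lt_succ i.2, j, rfl⟩
    refine deriv_mem_of_isAlgebraic hle (fun y hy => ?_) hx
      (isAlgebraic_of_trdeg_eq hle ?_ ?_ hx)
    · exact deriv_mem_of_mem_adjoin _ (hmono.trans hsub)
        (by rintro _ ⟨i, hi, j, rfl⟩; exact hsub (hstep i hi j)) hy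
    · exact trdeg_adjoin_lt_aleph0 (by rw [hS]; exact Set.finite_range _)
    · rw [← hdim, ← hdim]; exact h _ N.le_succ

open MvPolynomial in
/-- If the field generated by a finite tuple `c` is closed under the derivation, then so is the
algebra generated by `c` and the inverse of a common denominator `g(c)` of the derivatives. -/
theorem exists_deriv_eq_aeval {ι : Type*} [Finite ι] (c : ι → K)
    (hc : ∀ i, Differential.deriv (c i) ∈ IntermediateField.adjoin k (Set.range c)) :
    ∃ g : MvPolynomial ι k, aeval c g ≠ 0 ∧
      ∀ i : Option ι, ∃ s : MvPolynomial (Option ι) k,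
        Differential.deriv ((Option.elim i (aeval c g)⁻¹ c : K)) =
          aeval (fun i : Option ι => (Option.elim i (aeval c g)⁻¹ c : K)) s := by
  classical
  have := Fintype.ofFinite ι
  have hrs : ∀ i, ∃ r s : MvPolynomial ι k, aeval c s ≠ 0 ∧
      Differential.deriv (c i) = aeval c r / aeval c s := by
    intro i
    obtain ⟨r, s, h⟩ := (IntermediateField.mem_adjoin_range_iff k c _).1 (hc i)
    by_cases hs : aeval c s = 0
    · exact ⟨0, 1, by simp, by rw [h, hs]; simp⟩
    · exact ⟨r, s, hs, h⟩
  choose r s hs h using hrs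
  have hg : aeval c (∏ i, s i) ≠ 0 := by
    rw [map_prod]; exact Finset.prod_ne_zero_iff.2 fun i _ => hs i
  refine ⟨∏ i, s i, hg, ?_⟩
  set b : Option ι → K := fun i => (Option.elim i (aeval c (∏ i, s i))⁻¹ c : K) with hb
  let R : Subalgebra k K := Algebra.adjoin k (Set.range b)
  have hR : ∀ x ∈ R, ∃ p : MvPolynomial (Option ι) k, x = aeval b p := by
    intro x hx
    have hx : x ∈ Algebra.adjoin k (Set.range b) := hx
    rw [Algebra.adjoin_range_eq_range_aeval] at hx
    obtain ⟨p, rfl⟩ := hx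
    exact ⟨p, rfl⟩
  have hcR : Set.range c ⊆ R := by
    rintro _ ⟨i, rfl⟩
    exact Algebra.subset_adjoin ⟨some i, rfl⟩
  have hpR : ∀ p : MvPolynomial ι k, aeval c p ∈ Algebra.adjoin k (Set.range c) := by
    intro p
    rw [Algebra.adjoin_range_eq_range_aeval]
    exact ⟨p, rfl⟩
  have hpR' : ∀ p : MvPolynomial ι k, aeval c p ∈ R := fun p => Algebra.adjoin_le hcR (hpR p)
  have hinv : (aeval c (∏ i, s i))⁻¹ ∈ R := Algebra.subset_adjoin ⟨none, rfl⟩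
  have hdc : ∀ i, Differential.deriv (c i) ∈ R := by
    intro i
    have : Differential.deriv (c i) =
        aeval c (r i) * aeval c (∏ j ∈ Finset.univ.erase i, s j) * (aeval c (∏ i, s i))⁻¹ := by
      rw [h i, ← Finset.mul_prod_erase Finset.univ s (Finset.mem_univ i), map_mul]
      have h2 : aeval c (∏ j ∈ Finset.univ.erase i, s j) ≠ 0 := by
        rw [map_prod]; exact Finset.prod_ne_zero_iff.2 fun i _ => hs i
      have := hs i
      field_simp
    rw [this]
    exact mul_mem (mul_mem (hpR' _) (hpR' _)) hinv
  rintro (_ | i)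
  · refine hR _ ?_
    change Differential.deriv (aeval c (∏ i, s i))⁻¹ ∈ R
    rw [Derivation.leibniz_inv]
    exact mul_mem (neg_mem (pow_mem hinv 2)) (deriv_mem_of_mem_algebraAdjoin R hcR
      (by rintro _ ⟨i, rfl⟩; exact hdc i) (hpR _))
  · exact hR _ (hdc i)

end Algebra

/-! ### Prolongations and `D`-points -/

section Prolongation

open MvPolynomial AffineVariety

variable {k : Type v} {K : Type u} [Field k] [Differential k] [Field K] [Algebra k K] {ι : Type}

lemma coeff_mapDeriv (f : MvPolynomial ι k) (m : ι →₀ ℕ) :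
    (mapDeriv f).coeff m = Differential.deriv (f.coeff m) := by
  classical
  simp only [mapDeriv, coeff_sum, coeff_monomial, Finset.sum_ite_eq', mem_support_iff]
  split_ifs with h
  · rfl
  · rw [not_not.1 h, map_zero]

lemma mapDeriv_C (a : k) : mapDeriv (C a : MvPolynomial ι k) = C (Differential.deriv a) := by
  classical
  ext m
  simp only [coeff_mapDeriv, coeff_C]
  split_ifs <;> simp

lemma mapDeriv_add (f g : MvPolynomial ι k) : mapDeriv (f + g) = mapDeriv f + mapDeriv g := by
  ext m
  simp only [coeff_mapDeriv, coeff_add, map_add]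

lemma mapDeriv_mul_X (f : MvPolynomial ι k) (i : ι) : mapDeriv (f * X i) = mapDeriv f * X i := by
  classical
  ext m
  simp only [coeff_mapDeriv, coeff_mul_X']
  split_ifs <;> simp

lemma aeval_prolongPoly [Fintype ι] (f : MvPolynomial ι k) (u : ι ⊕ ι → K) :
    aeval u (prolongPoly f) = aeval (u ∘ Sum.inl) (mapDeriv f) +
      ∑ i, aeval (u ∘ Sum.inl) (pderiv i f) * u (Sum.inr i) := by
  simp [prolongPoly, aeval_rename]

/-- The derivative of `f` along the vector field `s`: the polynomial whose value at any `b` with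
`δ b = s(b)` is `δ (f(b))`. -/
def derivAlong [Fintype ι] (s : ι → MvPolynomial ι k) (f : MvPolynomial ι k) : MvPolynomial ι k :=
  mapDeriv f + ∑ i, pderiv i f * s i

lemma aeval_derivAlong [Fintype ι] (s : ι → MvPolynomial ι k) (f : MvPolynomial ι k) (b : ι → K) :
    aeval b (derivAlong s f) =
      aeval (Sum.elim b fun i => aeval b (s i)) (prolongPoly f) := by
  simp [derivAlong, aeval_prolongPoly]

variable [Differential K] [DifferentialAlgebra k K]

lemma deriv_aeval [Fintype ι] (f : MvPolynomial ι k) (b : ι → K) :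
    Differential.deriv (aeval b f) =
      aeval (Sum.elim b fun i => Differential.deriv (b i)) (prolongPoly f) := by
  classical
  rw [aeval_prolongPoly]
  simp only [Sum.elim_comp_inl, Sum.elim_inr]
  induction f using MvPolynomial.induction_on with
  | C a => simp [mapDeriv_C, deriv_algebraMap]
  | add p q hp hq =>
    simp only [map_add, hp, hq, mapDeriv_add, add_mul, Finset.sum_add_distrib]
    ring
  | mul_X p i hp =>
    simp only [map_mul, aeval_X, Derivation.leibniz, hp, mapDeriv_mul_X, smul_eq_mul, pderiv_X,
      map_add, add_mul, Finset.sum_add_distrib, Pi.single_apply, mul_add, Finset.mul_sum]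
    simp only [apply_ite (aeval b), map_one, map_zero, mul_ite, mul_one, mul_zero, ite_mul, zero_mul,
      Finset.sum_ite_eq, Finset.mem_univ, if_true]
    rw [add_comm, add_assoc, add_comm (∑ _, _)]
    congr 1
    · ring
    · congr 1
      exact Finset.sum_congr rfl fun j _ => by ring

omit [Differential K] [DifferentialAlgebra k K] in
lemma mem_prolongation_iff [Fintype ι] (V : AffineVariety k K ι) (u : ι ⊕ ι → K) :
    u ∈ V.prolongation.points ↔ ∀ f ∈ V.ideal,
      aeval (u ∘ Sum.inl) f = 0 ∧ aeval u (prolongPoly f) = 0 := by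
  simp only [prolongation, zeroLocus_span, Set.mem_ofPred_eq, Set.mem_union]
  constructor
  · intro h f hf
    refine ⟨?_, h _ (Or.inr ⟨f, hf, rfl⟩)⟩
    rw [← aeval_rename]
    exact h _ (Or.inl ⟨f, hf, rfl⟩)
  · rintro h _ (⟨f, hf, rfl⟩ | ⟨f, hf, rfl⟩)
    · rw [aeval_rename]; exact (h f hf).1
    · exact (h f hf).2

/-- Over `(K, δ)` the prolongation of the point `a` is the point `(a, δ a)`. -/
lemma mem_prolongation_point_iff [Fintype ι] (a : ι → K) (u : ι ⊕ ι → K) :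
    u ∈ (point a).prolongation.points ↔ u = Sum.elim a fun i => Differential.deriv (a i) := by
  classical
  rw [mem_prolongation_iff]
  have hid : ∀ f : MvPolynomial ι K, f ∈ (point a).ideal ↔ aeval a f = 0 :=
    fun f => mem_vanishingIdeal_singleton_iff a f
  constructor
  · intro h
    have hX : ∀ i, aeval a (X i - C (a i) : MvPolynomial ι K) = 0 := by simp
    have hl : u ∘ Sum.inl = a := by
      funext i
      have := (h _ ((hid _).2 (hX i))).1
      simpa [sub_eq_zero] using this
    funext z
    rcases z with i | i
    · exact congrFun hl i
    · have h₁ := (h _ ((hid _).2 (hX i))).2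
      have h₂ := deriv_aeval (X i - C (a i) : MvPolynomial ι K) a
      rw [hX, map_zero] at h₂
      rw [aeval_prolongPoly, hl] at h₁
      rw [aeval_prolongPoly] at h₂
      have h₃ := h₁.trans h₂
      simpa [pderiv_X, Pi.single_apply, apply_ite (aeval a)] using h₃
  · rintro rfl f hf
    rw [hid] at hf
    refine ⟨by simpa using hf, ?_⟩
    rw [← deriv_aeval, hf, map_zero]

omit [DifferentialAlgebra k K] in
lemma DVariety.isDPoint_iff {n : ℕ} (X : DVariety k K n) (a : Fin n → K) :
    X.IsDPoint a ↔ ∃ h : a ∈ X.V.points,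
      ∀ i, (X.s ⟨a, h⟩).1 (Sum.inr i) = Differential.deriv (a i) := by
  constructor
  · rintro ⟨h, hs⟩
    have := hs a rfl
    rw [mem_prolongation_point_iff] at this
    exact ⟨h rfl, fun i => congrFun this (Sum.inr i)⟩
  · rintro ⟨h, hs⟩
    refine ⟨fun w hw => (show w = a from hw) ▸ h, ?_⟩
    rintro w rfl
    rw [mem_prolongation_point_iff]
    funext z
    rcases z with i | i
    · exact X.isSection ⟨w, h⟩ i
    · exact hs i

end Prolongation

/-! ### The `D`-variety of a tuple whose derivatives are polynomials in it -/

section Locus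

open MvPolynomial AffineVariety

variable {k : Type v} {K : Type u} [Field k] [Field K] [Algebra k K]

variable (k) in
/-- The Zariski locus of `b` over `k`. -/
def locus {ι : Type} (b : ι → K) : AffineVariety k K ι where
  points := zeroLocus K (vanishingIdeal k {b})
  isClosed := ⟨_, rfl⟩

lemma mem_locus_iff {ι : Type} (b v : ι → K) :
    v ∈ (locus k b).points ↔ ∀ f : MvPolynomial ι k, aeval b f = 0 → aeval v f = 0 :=
  forall_congr' fun f => by rw [mem_vanishingIdeal_singleton_iff]

lemma mem_locus_self {ι : Type} (b : ι → K) : b ∈ (locus k b).points :=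
  (mem_locus_iff b b).2 fun _ => id

lemma mem_ideal_locus_iff {ι : Type} (b : ι → K) (f : MvPolynomial ι k) :
    f ∈ (locus k b).ideal ↔ aeval b f = 0 :=
  ⟨fun h => h b (mem_locus_self b), fun h _ hv => (mem_locus_iff b _).1 hv f h⟩

/-- The locus of `b` is the least variety over `k` containing `b`. -/
lemma locus_subset {ι : Type} {b : ι → K} {W : AffineVariety k K ι} (hb : b ∈ W.points) :
    (locus k b).points ⊆ W.points := by
  obtain ⟨I, hI⟩ := W.isClosed
  intro v hv
  rw [hI] at hb ⊢
  exact fun f hf => (mem_locus_iff b v).1 hv f (hb f hf)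

lemma locus_isIrreducible {ι : Type} (b : ι → K) : (locus k b).IsIrreducible :=
  ⟨⟨b, mem_locus_self b⟩, fun _ _ h =>
    (h (mem_locus_self b)).imp (fun hb => locus_subset hb) fun hb => locus_subset hb⟩

/-- A point of the locus of `b` is contained in no proper subvariety if and only if it satisfies the
same polynomial equations as `b`. -/
lemma forall_subvariety_eq_locus_iff {ι : Type} (b v : ι → K) :
    (v ∈ (locus k b).points ∧ ∀ W : AffineVariety k K ι, W.points ⊆ (locus k b).points →
      v ∈ W.points → W.points = (locus k b).points) ↔
    ∀ f : MvPolynomial ι k, aeval b f = 0 ↔ aeval v f = 0 := by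
  constructor
  · rintro ⟨hv, h⟩ f
    refine ⟨(mem_locus_iff b v).1 hv f, fun hf => ?_⟩
    have := h (locus k v) (locus_subset hv) (mem_locus_self v)
    exact (mem_locus_iff v b).1 (this ▸ mem_locus_self b) f hf
  · intro h
    have hb : b ∈ (locus k v).points := (mem_locus_iff v b).2 fun f => (h f).2
    exact ⟨(mem_locus_iff b v).2 fun f => (h f).1, fun W hW hvW =>
      hW.antisymm ((locus_subset hb).trans (locus_subset hvW))⟩

variable [Differential k] [Differential K] [DifferentialAlgebra k K]

/-- The `D`-variety on the locus of `b` whose section is the polynomial vector field `s` with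
`δ b = s(b)`. It takes values in the prolongation on all of the locus, since it does at `b`. -/
def DVariety.ofTuple {n : ℕ} (b : Fin n → K) (s : Fin n → MvPolynomial (Fin n) k)
    (hs : ∀ i, Differential.deriv (b i) = aeval b (s i)) : DVariety k K n where
  V := locus k b
  s v := ⟨Sum.elim v.1 fun i => aeval v.1 (s i), by
    rw [mem_prolongation_iff]
    intro f hf
    refine ⟨hf v.1 v.2, ?_⟩
    rw [mem_ideal_locus_iff] at hf
    rw [← aeval_derivAlong]
    refine (mem_locus_iff b v.1).1 v.2 _ ?_
    rw [aeval_derivAlong, ← funext hs, ← deriv_aeval, hf, map_zero]⟩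
  isMorphism := ⟨Sum.elim X s, by rintro v (i | i) <;> simp⟩
  isSection _ _ := rfl

lemma DVariety.isGenericDPoint_ofTuple_iff {n : ℕ} (b : Fin n → K)
    (s : Fin n → MvPolynomial (Fin n) k)
    (hs : ∀ i, Differential.deriv (b i) = aeval b (s i)) (v : Fin n → K) :
    (DVariety.ofTuple b s hs).IsGenericDPoint v ↔
      (∀ i, Differential.deriv (v i) = aeval v (s i)) ∧
        ∀ f : MvPolynomial (Fin n) k, aeval b f = 0 ↔ aeval v f = 0 := by
  rw [← forall_subvariety_eq_locus_iff, DVariety.IsGenericDPoint, DVariety.isDPoint_iff]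
  constructor
  · rintro ⟨⟨h, hv⟩, hW⟩
    exact ⟨fun i => (hv i).symm, h, hW⟩
  · rintro ⟨hv, h, hW⟩
    exact ⟨⟨h, fun i => (hv i).symm⟩, hW⟩

/-! ### Polynomials and terms -/

/-- On the solutions of `δ b = s(b)` every term is a polynomial. -/
lemma exists_aeval_eq_realize {n : ℕ} (s : Fin n → MvPolynomial (Fin n) k)
    (t : dRing.Term (params k K ⊕ Fin n)) : ∃ P : MvPolynomial (Fin n) k,
      ∀ b : Fin n → K, (∀ i, Differential.deriv (b i) = aeval b (s i)) →
        t.realize (Sum.elim (↑) b) = aeval b P := by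
  induction t with
  | var z =>
    rcases z with ⟨_, a, rfl⟩ | i
    · exact ⟨C a, fun b _ => by simp⟩
    · exact ⟨X i, fun b _ => by simp⟩
  | @func l f ts ih =>
    choose P hP using ih
    cases f
    · exact ⟨0, fun b _ => by rw [map_zero]; rfl⟩
    · exact ⟨1, fun b _ => by rw [map_one]; rfl⟩
    · exact ⟨-P 0, fun b hb => by rw [map_neg, ← hP 0 b hb]; rfl⟩
    · exact ⟨P 0 + P 1, fun b hb => by rw [map_add, ← hP 0 b hb, ← hP 1 b hb]; rfl⟩
    · exact ⟨P 0 * P 1, fun b hb => by rw [map_mul, ← hP 0 b hb, ← hP 1 b hb]; rfl⟩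
    · refine ⟨derivAlong s (P 0), fun b hb => ?_⟩
      rw [aeval_derivAlong, ← funext hb, ← deriv_aeval, ← hP 0 b hb]
      rfl

/-- A generic solution of `δ b = s(b)` on a variety is determined up to quantifier-free
equivalence. -/
lemma qfEquiv_of_aeval_eq_zero_iff {n : ℕ} {s : Fin n → MvPolynomial (Fin n) k} {b v : Fin n → K}
    (hb : ∀ i, Differential.deriv (b i) = aeval b (s i))
    (hv : ∀ i, Differential.deriv (v i) = aeval v (s i))
    (h : ∀ f : MvPolynomial (Fin n) k, aeval b f = 0 ↔ aeval v f = 0) :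
    QfEquiv (params k K) b v := by
  intro t₁ t₂
  obtain ⟨P₁, h₁⟩ := exists_aeval_eq_realize s t₁
  obtain ⟨P₂, h₂⟩ := exists_aeval_eq_realize s t₂
  rw [h₁ b hb, h₁ v hv, h₂ b hb, h₂ v hv]
  simpa [sub_eq_zero] using h (P₁ - P₂)

omit [Differential k] [DifferentialAlgebra k K] in
variable (K) in
lemma exists_realize_eq_aeval {α : Type*} (P : MvPolynomial α k) :
    ∃ t : dRing.Term (params k K ⊕ α),
      ∀ v : α → K, t.realize (Sum.elim (↑) v) = aeval v P := by
  induction P using MvPolynomial.induction_on with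
  | C a => exact ⟨Term.var (Sum.inl ⟨_, a, rfl⟩), fun v => by simp⟩
  | add p q hp hq =>
    obtain ⟨t₁, h₁⟩ := hp
    obtain ⟨t₂, h₂⟩ := hq
    exact ⟨addTerm t₁ t₂, fun v => by rw [realize_addTerm, h₁, h₂, map_add]⟩
  | mul_X p i hp =>
    obtain ⟨t, h⟩ := hp
    exact ⟨mulTerm t (Term.var (Sum.inr i)), fun v => by simp [h]⟩

omit [Differential k] [DifferentialAlgebra k K] in
lemma QfEquiv.aeval_eq_zero_iff {α : Type*} {v w : α → K} (h : QfEquiv (params k K) v w)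
    (P : MvPolynomial α k) : aeval v P = 0 ↔ aeval w P = 0 := by
  obtain ⟨t, ht⟩ := exists_realize_eq_aeval K P
  simpa [ht] using h t zeroTerm

omit [Differential k] [DifferentialAlgebra k K] in
lemma QfEquiv.iterate_deriv_eq_aeval_iff {α : Type*} {v w : α → K} (h : QfEquiv (params k K) v w)
    (i : ℕ) (j : α) (P : MvPolynomial α k) :
    (fun y : K => Differential.deriv y)^[i] (v j) = aeval v P ↔
      (fun y : K => Differential.deriv y)^[i] (w j) = aeval w P := by
  obtain ⟨t, ht⟩ := exists_realize_eq_aeval K P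
  simpa [ht] using h (derTerm^[i] (Term.var (Sum.inr j))) t

end Locus

/-! ### Interdefinability with the generic type -/

section Interdefinable

open MvPolynomial

variable {k : Type v} {K : Type u} [Field k] [Differential k] [Field K] [Differential K]
  [Algebra k K] [DifferentialAlgebra k K]

/-- The type of `b` over `k` is the generic type of the `D`-variety of `b`. -/
theorem isGenericType_typeOf (hK : IsDCF K) {κ : Cardinal.{u}} (hsat : IsSaturated K κ)
    (hκ : ℵ₀ ≤ κ) (hk : #(params k K) < κ) {n : ℕ} (b : Fin n → K)
    (s : Fin n → MvPolynomial (Fin n) k)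
    (hs : ∀ i, Differential.deriv (b i) = aeval b (s i)) :
    (DVariety.ofTuple b s hs).IsGenericType
      ((dRing[[params k K]].completeTheory K).typeOf b) := by
  intro v
  rw [DVariety.isGenericDPoint_ofTuple_iff]
  constructor
  · intro hv
    have h : QfEquiv (params k K) b v := qfEquiv_of_typeOf_eq hv.symm
    exact ⟨fun i => (h.iterate_deriv_eq_aeval_iff 1 i (s i)).1 (hs i), h.aeval_eq_zero_iff⟩
  · rintro ⟨hv, h⟩
    exact ((qfEquiv_of_aeval_eq_zero_iff hs hv h).typeOf_eq hK hsat hκ hk).symm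

omit [Differential k] [DifferentialAlgebra k K] in
lemma aeval_mem_dcl {C : Set K} (hC : params k K ⊆ dcl C) {ι : Type*} {c : ι → K}
    (hc : ∀ i, c i ∈ dcl C) (P : MvPolynomial ι k) : aeval c P ∈ dcl C := by
  let F : IntermediateField k K := (dclSubfield C).toIntermediateField fun x => hC ⟨x, rfl⟩
  have hle : Algebra.adjoin k (Set.range c) ≤ F.toSubalgebra :=
    Algebra.adjoin_le (by rintro _ ⟨i, rfl⟩; exact hc i)
  refine hle ?_
  rw [Algebra.adjoin_range_eq_range_aeval]
  exact ⟨P, rfl⟩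

omit [Differential k] [DifferentialAlgebra k K] in
/-- A tuple is interdefinable over `k` with the tuple consisting of its jet of positive length and
the inverse of a polynomial in the jet. -/
lemma dcl_union_range_eq {m M : ℕ} {a : Fin m → K} (hM : 0 < M)
    {g : MvPolynomial (Fin M × Fin m) k} {n : ℕ} (e : Option (Fin M × Fin m) ≃ Fin n)
    {b : Fin n → K} (hjet : ∀ x, b (e (some x)) = jet M a x)
    (hinv : b (e none) = (aeval (jet M a) g)⁻¹) :
    dcl (params k K ∪ Set.range a) = dcl (params k K ∪ Set.range b) := by
  apply subset_antisymm
  · refine dcl_subset_dcl (Set.union_subset (Set.subset_union_left.trans subset_dcl) ?_)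
    rintro _ ⟨j, rfl⟩
    refine subset_dcl (Or.inr ⟨e (some (⟨0, hM⟩, j)), ?_⟩)
    rw [hjet]
    rfl
  · have hA : params k K ⊆ dcl (params k K ∪ Set.range a) :=
      Set.subset_union_left.trans subset_dcl
    have hj : ∀ x, jet M a x ∈ dcl (params k K ∪ Set.range a) := fun x =>
      iterate_deriv_mem_dcl (a := a x.2) (subset_dcl (Or.inr ⟨x.2, rfl⟩)) _
    refine dcl_subset_dcl (Set.union_subset hA ?_)
    rintro _ ⟨i, rfl⟩
    obtain ⟨o, rfl⟩ := e.surjective i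
    rcases o with _ | x
    · rw [hinv]
      exact (dclSubfield (params k K ∪ Set.range a)).inv_mem (aeval_mem_dcl hA hj g)
    · rw [hjet]; exact hj x

end Interdefinable

end DCF

end

theorem theorem3 {K : Type u} [Field K] [Differential K] (hK : DCF.IsDCF K)
    (κ : Cardinal.{u}) (hsat : DCF.IsSaturated K κ)
    {k : Type v} [Field k] [Differential k] [Algebra k K] [DifferentialAlgebra k K]
    (hk : #(DCF.params k K) < κ)
    (m : ℕ) (p : DCF.TypeOver (DCF.params k K) m) (hp : DCF.FiniteDimensionalType p) :
    ∃ (n : ℕ) (X : DCF.DVariety k K n) (q : DCF.TypeOver (DCF.params k K) n),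
      X.V.IsIrreducible ∧ X.IsGenericType q ∧ DCF.Interdefinable p q := by
  have := hK.charZero
  have : CharZero k := (RingHom.charZero_iff (algebraMap k K).injective).2 this
  have hκ : ℵ₀ ≤ κ :=
    (Cardinal.infinite_iff.1 (Set.infinite_range_of_injective
      (algebraMap k K).injective).to_subtype).trans hk.le
  obtain ⟨a, ha, N, hN⟩ := hp
  obtain ⟨g, hg, hs⟩ := DCF.exists_deriv_eq_aeval _ (DCF.exists_deriv_jet_mem_adjoin a hN)
  let e := Finite.equivFin (Option (Fin (N + 2) × Fin m))
  let c : Option (Fin (N + 2) × Fin m) → K := fun i =>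
    Option.elim i (MvPolynomial.aeval (DCF.jet (N + 2) a) g)⁻¹ (DCF.jet (N + 2) a)
  let b : Fin _ → K := c ∘ e.symm
  have hb : ∀ o, b (e o) = c o := fun o => congrArg c (e.symm_apply_apply o)
  choose s hs using hs
  have hsb : ∀ i, Differential.deriv (b i) =
      MvPolynomial.aeval b (MvPolynomial.rename e (s (e.symm i))) := by
    intro i
    rw [MvPolynomial.aeval_rename, show b ∘ e = c from funext hb]
    exact hs (e.symm i)
  refine ⟨_, DCF.DVariety.ofTuple b _ hsb, _, DCF.locus_isIrreducible b,
    DCF.isGenericType_typeOf hK hsat hκ hk b _ hsb, fun a' ha' => ?_⟩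
  -- move `b` along an elementary map taking `a` to the given realisation `a'`
  have hcard : #(DCF.params k K ∪ Set.range a' : Set K) < κ :=
    (mk_union_le _ _).trans_lt
      (add_lt_of_lt hκ hk ((lt_aleph0_of_finite _).trans_le hκ))
  obtain ⟨b', h⟩ := (DCF.qfEquiv_of_typeOf_eq (ha.trans ha'.symm)).exists_extension hK hsat hcard b
  have hjet : ∀ x, b' (e (some x)) = DCF.jet (N + 2) a' x := by
    intro x
    have := (h.iterate_deriv_eq_aeval_iff x.1 (Sum.inl x.2)
      (MvPolynomial.X (Sum.inr (e (some x))))).1 (by simp [hb, c, DCF.jet])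
    simpa [DCF.jet] using this.symm
  refine ⟨b', ((h.comp Sum.inr).typeOf_eq hK hsat hκ hk).symm, ?_⟩
  refine DCF.dcl_union_range_eq (Nat.succ_pos _) (g := g) e hjet ?_
  have hmul := (h.aeval_eq_zero_iff (MvPolynomial.X (Sum.inr (e none)) *
    MvPolynomial.rename (fun x => Sum.inr (e (some x))) g - 1)).1 (by
      simp [MvPolynomial.aeval_rename, Function.comp_def, hb, c, hg])
  simp only [map_sub, map_mul, MvPolynomial.aeval_X, MvPolynomial.aeval_rename, map_one,
    Function.comp_def, Sum.elim_inr, hjet, sub_eq_zero] at hmul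
  exact eq_inv_of_mul_eq_one_left hmul
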